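/- Let $0<p<1$, and let $u_0:\mathbb{R}\to\mathbb{R}$ be nonnegative, not identically zero, continuous and piecewise $C^1$, with support contained in $[-1,1]$. Let $u$ be the global classical solution of the sublinear Fujita problem $$u_t=u_{xx}+[u^p]^+\quad (x\in\mathbb{R},\ t>0),\qquad u(x,0)=u_0(x)\quad (x\in\mathbb{R}),$$ where $[u^p]^+=u^p$ for $u\ge 0$ and $[u^p]^+=0$ for $u<0$; that is, $u$ is continuous on $\mathbb{R}\times[0,\infty)$, has continuous derivatives $u_t,u_x,u_{xx}$ on $\mathbb{R}\times(0,\infty)$, is bounded on $\mathbb{R}\times[0,T]$ for every $T>0$, and satisfies the equation and the initial condition. For $s,x\in\mathbb{R}$ and $t>1$ put $$\Delta(s,u_0)=\frac{1}{2\sqrt{\pi}}\int_{-1}^{1}u_0(w)\,e^{-\frac14(w-s)^2}\,dw,\qquad \mathcal{E}(s;p,u_0)=\bigl((1-p)+\Delta(s,u_0)^{1-p}\bigr)^{\frac{1}{1-p}}-(1-p)^{\frac{1}{1-p}},$$ $$c_-(x,t,p,u_0)=\frac{(1+\|u_0\|_\infty)^{-1}}{2\sqrt{\pi(1-p)}}\int_{-1}^{1}u_0(s)\,e^{-\frac{(s-x)^2}{4t}}\,ds,$$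 $$c_+(x,t,p,u_0)=\frac{(1-p)^{\frac{1-2p}{1-p}}}{\sqrt{2\pi(1-p)}}\int_{-\infty}^{\infty}\mathcal{E}(s;p,u_0)\,e^{-\frac{(s-x)^2}{4(t-1)}}\,ds .$$ Then the integral defining $c_+$ converges, $c_\pm(x,t,p,u_0)>0$ for all $x\in\mathbb{R}$ and $t>1$, and there are constants $T>1$ and $M$ (depending on $p$ and $u_0$) such that, for all $t\ge T$ and all $x\in\mathbb{R}$, both $c_\pm(x,t,p,u_0)\le M$ and $$c_-(x,t,p,u_0)\,((1-p)t)^{\frac{3p-1}{2(1-p)}}\ \le\ u(x,t)-((1-p)t)^{\frac{1}{1-p}}\ \le\ c_+(x,t,p,u_0)\,((1-p)t)^{\frac{3p-1}{2(1-p)}} .$$ -/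

import Mathlib

namespace SublinearFujita

open Set Filter Topology MeasureTheory

/-- The reaction function `[u^p]^+`: equal to `u^p` for `u ≥ 0` and to `0` for `u < 0`. -/
noncomputable def reaction (p u : ℝ) : ℝ := if 0 ≤ u then u ^ p else 0

/-- `f` is piecewise `C¹` on `ℝ`: off a locally finite set of points it is differentiable with
continuous derivative, and at each exceptional point the derivative has finite one-sided limits. -/
def PiecewiseC1 (f : ℝ → ℝ) : Prop :=
  ∃ S : Set ℝ, (∀ a b : ℝ, (S ∩ Icc a b).Finite) ∧
    (∀ x, x ∉ S → DifferentiableAt ℝ f x ∧ ContinuousAt (deriv f) x) ∧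
    (∀ x ∈ S, (∃ l : ℝ, Tendsto (deriv f) (𝓝[<] x) (𝓝 l)) ∧
      (∃ r : ℝ, Tendsto (deriv f) (𝓝[>] x) (𝓝 r)))

/-- The class `K⁺(ℝ)` of initial data. -/
structure IsInitialDatum (u₀ : ℝ → ℝ) : Prop where
  continuous : Continuous u₀
  piecewiseC1 : PiecewiseC1 u₀
  nonneg : ∀ x, 0 ≤ u₀ x
  nontrivial : ∃ x, u₀ x ≠ 0
  support_subset : tsupport u₀ ⊆ Icc (-1) 1

/-- `u x t` is of class `C^{2,1}` on `D_∞ = ℝ × (0, ∞)`: the partial derivatives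
`u_t`, `u_x`, `u_xx` exist and are (jointly) continuous there. -/
structure IsC21 (u : ℝ → ℝ → ℝ) : Prop where
  differentiable_t : ∀ x t, 0 < t → DifferentiableAt ℝ (fun s => u x s) t
  differentiable_x : ∀ x t, 0 < t → DifferentiableAt ℝ (fun y => u y t) x
  differentiable_xx : ∀ x t, 0 < t → DifferentiableAt ℝ (deriv (fun y => u y t)) x
  continuousOn_t :
    ContinuousOn (fun q : ℝ × ℝ => deriv (fun s => u q.1 s) q.2) (univ ×ˢ Ioi 0)
  continuousOn_x :
    ContinuousOn (fun q : ℝ × ℝ => deriv (fun y => u y q.2) q.1) (univ ×ˢ Ioi 0)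
  continuousOn_xx :
    ContinuousOn (fun q : ℝ × ℝ => deriv (deriv (fun y => u y q.2)) q.1) (univ ×ˢ Ioi 0)

/-- `u` is a global classical solution of the problem `u_t = u_xx + [u^p]^+`, `u(·, 0) = u₀`.
Only the values `u x t` with `t ≥ 0` matter. -/
structure IsGlobalSolution (p : ℝ) (u₀ : ℝ → ℝ) (u : ℝ → ℝ → ℝ) : Prop where
  continuousOn : ContinuousOn (fun q : ℝ × ℝ => u q.1 q.2) (univ ×ˢ Ici 0)
  isC21 : IsC21 u
  equation : ∀ x t, 0 < t →
    deriv (fun s => u x s) t = deriv (deriv (fun y => u y t)) x + reaction p (u x t)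
  initial : ∀ x, u x 0 = u₀ x
  bounded : ∀ T, 0 < T → ∃ M : ℝ, ∀ x t, 0 ≤ t → t ≤ T → |u x t| ≤ M

/-- The sup norm `‖u₀‖_∞`. -/
noncomputable def supNorm (u₀ : ℝ → ℝ) : ℝ := ⨆ x, |u₀ x|

/-- `Δ(s, u₀)`, the heat flow of `u₀` at time `1`. -/
noncomputable def heatOne (u₀ : ℝ → ℝ) (s : ℝ) : ℝ :=
  1 / (2 * √Real.pi) * ∫ w in (-1 : ℝ)..1, u₀ w * Real.exp (-(1 / 4) * (w - s) ^ 2)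

/-- The function `𝓔(s; p, u₀)`. -/
noncomputable def excess (p : ℝ) (u₀ : ℝ → ℝ) (s : ℝ) : ℝ :=
  ((1 - p) + heatOne u₀ s ^ (1 - p)) ^ (1 / (1 - p)) - (1 - p) ^ (1 / (1 - p))

/-- The coefficient `c₋(x, t, p, u₀)`. -/
noncomputable def cMinus (x t p : ℝ) (u₀ : ℝ → ℝ) : ℝ :=
  (1 + supNorm u₀)⁻¹ / (2 * √(Real.pi * (1 - p))) *
    ∫ s in (-1 : ℝ)..1, u₀ s * Real.exp (-((s - x) ^ 2 / (4 * t)))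

/-- The coefficient `c₊(x, t, p, u₀)`, for `t > 1`. -/
noncomputable def cPlus (x t p : ℝ) (u₀ : ℝ → ℝ) : ℝ :=
  (1 - p) ^ ((1 - 2 * p) / (1 - p)) / √(2 * Real.pi * (1 - p)) *
    ∫ s : ℝ, excess p u₀ s * Real.exp (-((s - x) ^ 2 / (4 * (t - 1))))

end SublinearFujita

namespace SublinearFujita

open Set Filter Topology MeasureTheory

/-! Everything rests on one comparison tool, `heat_minimum_principle`, applied to nonlinear changes
of the unknown that turn `u` into a super- or subsolution of the heat equation.

Lower bound: since the reaction is nonnegative, `u` dominates the heat flow of its data and is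
positive for `t > 0`. Then `z = u^(1-p)` satisfies `z_t - z_xx - (1-p) = p(1-p) u^(-1-p) u_x² ≥ 0`,
so `z` exceeds `(1-p)t` by at least the heat flow of `u₀^(1-p)` (`add_heatFlow_rpow_le`). Convexity
of `y^(1/(1-p))` converts this gain into a gain for `u`.

Upper bound: `(u^(1-p) - (1-p)t)^(1/(1-p))` is a subsolution (`rpow_sub_rpow_le_heatFlow`), which at
`t = 1` bounds the deviation from the homogeneous solution by `excess`. From then on, concavity of
`y^p` makes the deviation `w` satisfy `w_t ≤ w_xx + (p/(1-p)) w/t`; the integrating factor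
`t^(-p/(1-p))` removes the linear term and leaves a heat subsolution (`rescaled_sub_le_heatFlow`).
Starting at `t = 1` avoids the singularity of `1/t` at zero. -/

/-! ### Parabolic derivatives and the minimum principle. -/

/-- `ft`, `fx`, `fxx` are the partial derivatives of `f` on `ℝ × (0, ∞)`. -/
structure HasParabolicDeriv (f ft fx fxx : ℝ → ℝ → ℝ) : Prop where
  time : ∀ x t, 0 < t → HasDerivAt (fun s => f x s) (ft x t) t
  space : ∀ x t, 0 < t → HasDerivAt (fun y => f y t) (fx x t) x
  space₂ : ∀ x t, 0 < t → HasDerivAt (fun y => fx y t) (fxx x t) x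

lemma HasParabolicDeriv.sub {f ft fx fxx g gt gx gxx : ℝ → ℝ → ℝ}
    (hf : HasParabolicDeriv f ft fx fxx) (hg : HasParabolicDeriv g gt gx gxx) :
    HasParabolicDeriv (fun x t => f x t - g x t) (fun x t => ft x t - gt x t)
      (fun x t => fx x t - gx x t) (fun x t => fxx x t - gxx x t) where
  time x t ht := (hf.time x t ht).sub (hg.time x t ht)
  space x t ht := (hf.space x t ht).sub (hg.space x t ht)
  space₂ x t ht := (hf.space₂ x t ht).sub (hg.space₂ x t ht)

/-- Chain rule for real powers of a positive function. -/
lemma HasParabolicDeriv.rpow {f ft fx fxx : ℝ → ℝ → ℝ} (hf : HasParabolicDeriv f ft fx fxx)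
    (hpos : ∀ x t, 0 < t → 0 < f x t) (r : ℝ) :
    HasParabolicDeriv (fun x t => f x t ^ r) (fun x t => ft x t * r * f x t ^ (r - 1))
      (fun x t => fx x t * r * f x t ^ (r - 1))
      (fun x t => fxx x t * r * f x t ^ (r - 1) +
        fx x t * r * (fx x t * (r - 1) * f x t ^ (r - 1 - 1))) where
  time x t ht := (hf.time x t ht).rpow_const (Or.inl (hpos x t ht).ne')
  space x t ht := (hf.space x t ht).rpow_const (Or.inl (hpos x t ht).ne')
  space₂ x t ht := ((hf.space₂ x t ht).mul_const r).mul
    ((hf.space x t ht).rpow_const (Or.inl (hpos x t ht).ne'))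

/-- If `c < 0`, the second derivative test makes `a` a local maximum as well, so `f` is locally
constant there and `c = 0`. -/
lemma second_deriv_nonneg_of_isLocalMin {f f' : ℝ → ℝ} {a c : ℝ}
    (hf : ∀ y, HasDerivAt f (f' y) y) (hf' : HasDerivAt f' c a) (hmin : IsLocalMin f a) :
    0 ≤ c := by
  by_contra hc
  push Not at hc
  have hd : deriv f = f' := funext fun y => (hf y).deriv
  have hmax : IsLocalMax f a :=
    isLocalMax_of_deriv_deriv_neg (by rw [hd, hf'.deriv]; exact hc) hmin.deriv_eq_zero
      (hf a).continuousAt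
  have heq : f =ᶠ[𝓝 a] fun _ => f a := by
    filter_upwards [hmin, hmax] with y h1 h2 using le_antisymm h2 h1
  have h0 : deriv f =ᶠ[𝓝 a] fun _ => 0 := by
    have := heq.deriv
    simpa using this
  have h1 : deriv (deriv f) a = 0 := by
    rw [h0.deriv_eq]; simp
  rw [hd, hf'.deriv] at h1
  exact hc.ne h1

/-- Only left slopes are used, because the space-time minimum may lie at the final time. -/
lemma deriv_nonpos_of_forall_lt_le {f : ℝ → ℝ} {b c t : ℝ} (hf : HasDerivAt f c t) (hb : b < t)
    (hmin : ∀ s, b ≤ s → s < t → f t ≤ f s) : c ≤ 0 := by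
  have h := (hasDerivAt_iff_tendsto_slope_left_right.1 hf).1
  refine le_of_tendsto h ?_
  filter_upwards [Ioo_mem_nhdsLT hb] with s hs
  rw [slope_def_field]
  exact div_nonpos_of_nonneg_of_nonpos (sub_nonneg.2 (hmin s hs.1.le hs.2))
    (sub_nonpos.2 hs.2.le)

/-- Minimum principle for supersolutions of the heat equation on `ℝ × [0, ∞)` that are bounded
below on bounded time intervals. -/
theorem heat_minimum_principle {v vt vx vxx : ℝ → ℝ → ℝ}
    (hc : ContinuousOn (fun z : ℝ × ℝ => v z.1 z.2) (univ ×ˢ Ici 0))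
    (hd : HasParabolicDeriv v vt vx vxx)
    (hsup : ∀ x t, 0 < t → vxx x t ≤ vt x t)
    (hbd : ∀ T, 0 < T → ∃ M : ℝ, ∀ x t, 0 ≤ t → t ≤ T → -M ≤ v x t)
    (h0 : ∀ x, 0 ≤ v x 0) (x t : ℝ) (ht : 0 ≤ t) : 0 ≤ v x t := by
  rcases ht.eq_or_lt with rfl | ht
  · exact h0 x
  obtain ⟨M, hM⟩ := hbd t ht
  -- The quadratic penalty forces the minimum into a compact box. Its time slope `3` strictly beats
  -- `(x²)'' = 2`, so the penalised function is a strict supersolution.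
  have key : ∀ ε > 0, 0 ≤ v x t + ε * (x ^ 2 + 3 * t) := by
    intro ε hε
    set W : ℝ × ℝ → ℝ := fun z => v z.1 z.2 + ε * (z.1 ^ 2 + 3 * z.2) with hW
    -- Large enough that the box contains `x` and that `ε R² ≥ M`, so a negative minimum cannot sit
    -- on the lateral sides.
    set R : ℝ := |x| + |M| / ε + 1 with hR
    have hMε : 0 ≤ |M| / ε := by positivity
    have hR1 : 1 ≤ R := by have := abs_nonneg x; linarith
    have hxR : |x| ≤ R := by linarith
    have hRM : M ≤ ε * R ^ 2 := by
      have h1 : |M| / ε ≤ R ^ 2 := by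
        have := abs_nonneg x
        nlinarith
      rw [div_le_iff₀ hε] at h1
      linarith [le_abs_self M]
    have hcW : ContinuousOn W (Icc (-R) R ×ˢ Icc 0 t) := by
      refine (hc.mono (prod_mono (subset_univ _) Icc_subset_Ici_self)).add ?_
      fun_prop
    obtain ⟨⟨a, s⟩, ⟨ha, hs⟩, hmin⟩ := (isCompact_Icc.prod isCompact_Icc).exists_isMinOn
      ⟨(x, t), ⟨abs_le.1 hxR, ht.le, le_rfl⟩⟩ hcW
    simp only at ha hs
    have hle : ∀ y r, y ∈ Icc (-R) R → r ∈ Icc 0 t → W (a, s) ≤ W (y, r) :=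
      fun y r hy hr => hmin (a := (y, r)) ⟨hy, hr⟩
    by_contra hneg
    push Not at hneg
    have hlt : W (a, s) < 0 := lt_of_le_of_lt (hle x t (abs_le.1 hxR) ⟨ht.le, le_rfl⟩) hneg
    have hs0 : 0 < s := by
      rcases hs.1.eq_or_lt with h | h
      · exfalso
        have h2 : 0 ≤ W (a, s) := by
          rw [← h]
          simp only [hW]
          have := h0 a
          positivity
        linarith
      · exact h
    have haR : a ^ 2 < R ^ 2 := by
      by_contra hcon
      push Not at hcon
      have h2 : v a s + ε * (a ^ 2 + 3 * s) < 0 := hlt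
      have h3 := hM a s hs.1 hs.2
      have h4 : ε * R ^ 2 ≤ ε * a ^ 2 := by gcongr
      have h5 : 0 < ε * s := by positivity
      nlinarith
    have haR' : a ∈ Ioo (-R) R := abs_lt.1 (abs_lt_of_sq_lt_sq haR (by linarith))
    have htime : HasDerivAt (fun r => W (a, r)) (vt a s + ε * (3 * 1)) s :=
      (hd.time a s hs0).add ((((hasDerivAt_id s).const_mul 3).const_add (a ^ 2)).const_mul ε)
    have ht1 := deriv_nonpos_of_forall_lt_le htime hs0
      fun r hr hrs => hle a r ha ⟨hr, hrs.le.trans hs.2⟩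
    have hsp : ∀ y, HasDerivAt (fun y => W (y, s)) (vx y s + ε * (2 * y)) y := by
      intro y
      have h1 : HasDerivAt (fun y : ℝ => y ^ 2 + 3 * s) (2 * y) y := by
        simpa using (hasDerivAt_pow 2 y).add_const (3 * s)
      exact (hd.space y s hs0).add (h1.const_mul ε)
    have hsp2 : HasDerivAt (fun y => vx y s + ε * (2 * y)) (vxx a s + ε * (2 * 1)) a :=
      (hd.space₂ a s hs0).add (((hasDerivAt_id a).const_mul 2).const_mul ε)
    have hloc : IsLocalMin (fun y => W (y, s)) a := by
      filter_upwards [Ioo_mem_nhds haR'.1 haR'.2] with y hy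
      exact hle y s ⟨hy.1.le, hy.2.le⟩ hs
    have hx1 := second_deriv_nonneg_of_isLocalMin hsp hsp2 hloc
    -- At the minimum `vt + 3ε ≤ 0 ≤ vxx + 2ε`, contradicting `vxx ≤ vt`.
    have := hsup a s hs0
    linarith
  have hlim : Tendsto (fun ε : ℝ => v x t + ε * (x ^ 2 + 3 * t)) (𝓝[>] 0) (𝓝 (v x t)) := by
    have : Continuous fun ε : ℝ => v x t + ε * (x ^ 2 + 3 * t) := by fun_prop
    simpa using (this.tendsto 0).mono_left nhdsWithin_le_nhds
  exact ge_of_tendsto hlim (by filter_upwards [self_mem_nhdsWithin] with ε hε using key ε hε)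


/-! ### The heat flow and its derivatives. -/

/-- The heat flow of `g`, written so that it is meaningful and continuous up to `t = 0`. -/
noncomputable def heatFlow (g : ℝ → ℝ) (x t : ℝ) : ℝ :=
  (√Real.pi)⁻¹ * ∫ ξ : ℝ, g (x + 2 * √t * ξ) * Real.exp (-ξ ^ 2)

/-- The unnormalised heat integral. -/
noncomputable def heatIntegral (g : ℝ → ℝ) (x t : ℝ) : ℝ :=
  ∫ s : ℝ, g s * Real.exp (-((s - x) ^ 2 / (4 * t)))

lemma integrable_exp_neg_sq : Integrable fun ξ : ℝ => Real.exp (-ξ ^ 2) := by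
  simpa using integrable_exp_neg_mul_sq (b := 1) one_pos

lemma integral_exp_neg_sq : ∫ ξ : ℝ, Real.exp (-ξ ^ 2) = √Real.pi := by
  simpa using integral_gaussian 1

lemma heatFlow_zero (g : ℝ → ℝ) (x : ℝ) : heatFlow g x 0 = g x := by
  have : √Real.pi ≠ 0 := (Real.sqrt_pos.2 Real.pi_pos).ne'
  simp only [heatFlow, Real.sqrt_zero, mul_zero, zero_mul, add_zero]
  rw [integral_const_mul, integral_exp_neg_sq]
  field_simp

lemma continuous_heatFlow {g : ℝ → ℝ} (hg : Continuous g) {M : ℝ} (hM : ∀ x, |g x| ≤ M) :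
    Continuous fun z : ℝ × ℝ => heatFlow g z.1 z.2 := by
  refine continuous_const.mul ?_
  refine continuous_of_dominated (bound := fun ξ => M * Real.exp (-ξ ^ 2)) ?_ ?_ ?_ ?_
  · intro z
    exact Continuous.aestronglyMeasurable (by fun_prop)
  · intro z
    refine Eventually.of_forall fun ξ => ?_
    rw [Real.norm_eq_abs, abs_mul, Real.abs_exp]
    gcongr
    exact hM _
  · exact integrable_exp_neg_sq.const_mul M
  · exact Eventually.of_forall fun ξ => by fun_prop

lemma abs_heatFlow_le {g : ℝ → ℝ} {M : ℝ} (hM : ∀ x, |g x| ≤ M) (x t : ℝ) :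
    |heatFlow g x t| ≤ M := by
  have hpi : 0 < √Real.pi := Real.sqrt_pos.2 Real.pi_pos
  have h : |∫ ξ : ℝ, g (x + 2 * √t * ξ) * Real.exp (-ξ ^ 2)| ≤
      ∫ ξ : ℝ, M * Real.exp (-ξ ^ 2) := by
    rw [← Real.norm_eq_abs]
    refine norm_integral_le_of_norm_le (integrable_exp_neg_sq.const_mul M)
      (Eventually.of_forall fun ξ => ?_)
    rw [Real.norm_eq_abs, abs_mul, Real.abs_exp]
    gcongr
    exact hM _
  rw [integral_const_mul, integral_exp_neg_sq] at h
  rw [heatFlow, abs_mul, abs_of_pos (inv_pos.2 hpi), inv_mul_le_iff₀ hpi]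
  linarith

/-- The substitution `s = x + 2√t ξ` moves the dependence on `x` and `t` from `g` into the kernel,
so differentiation needs no smoothness of `g`. -/
lemma heatFlow_eq (g : ℝ → ℝ) (x : ℝ) {t : ℝ} (ht : 0 < t) :
    heatFlow g x t = (2 * √Real.pi)⁻¹ * (t ^ (-(1 / 2) : ℝ) * heatIntegral g x t) := by
  have hst : 0 < √t := Real.sqrt_pos.2 ht
  have hcv : ∫ ξ : ℝ, g (x + 2 * √t * ξ) * Real.exp (-ξ ^ 2) =
      (2 * √t)⁻¹ * heatIntegral g x t := by
    have h1 := Measure.integral_comp_mul_left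
      (fun y : ℝ => g (x + y) * Real.exp (-(y ^ 2 / (4 * t)))) (2 * √t)
    have h2 := integral_add_left_eq_self (μ := volume)
      (fun s : ℝ => g s * Real.exp (-((s - x) ^ 2 / (4 * t)))) x
    rw [abs_of_pos (by positivity), smul_eq_mul] at h1
    simp only [add_sub_cancel_left] at h2
    rw [heatIntegral, ← h2, ← h1]
    refine integral_congr_ae (Eventually.of_forall fun ξ => ?_)
    have : (2 * √t * ξ) ^ 2 / (4 * t) = ξ ^ 2 := by
      rw [mul_pow, mul_pow, Real.sq_sqrt ht.le]
      field_simp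
      ring
    simp only [this]
  rw [heatFlow, hcv, Real.rpow_neg ht.le, ← Real.sqrt_eq_rpow]
  field_simp

lemma sq_mul_exp_neg_le (y : ℝ) {t : ℝ} (ht : 0 < t) :
    y ^ 2 * Real.exp (-(y ^ 2 / (4 * t))) ≤ 4 * t := by
  have h1 : y ^ 2 / (4 * t) ≤ Real.exp (y ^ 2 / (4 * t)) := by
    linarith [Real.add_one_le_exp (y ^ 2 / (4 * t))]
  rw [Real.exp_neg, ← div_eq_mul_inv, div_le_iff₀ (Real.exp_pos _)]
  rw [div_le_iff₀ (by positivity)] at h1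
  linarith

lemma exp_neg_sq_div_le_one (y : ℝ) {t : ℝ} (ht : 0 < t) :
    Real.exp (-(y ^ 2 / (4 * t))) ≤ 1 :=
  Real.exp_le_one_iff.2 (neg_nonpos.2 (by positivity))

lemma abs_mul_exp_neg_le (y : ℝ) {t : ℝ} (ht : 0 < t) :
    |y| * Real.exp (-(y ^ 2 / (4 * t))) ≤ 1 + 4 * t := by
  have h1 : |y| ≤ 1 + y ^ 2 := by nlinarith [sq_abs y, sq_nonneg (|y| - 1)]
  have h2 := sq_mul_exp_neg_le y ht
  have h3 := exp_neg_sq_div_le_one y ht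
  have h4 := Real.exp_pos (-(y ^ 2 / (4 * t)))
  nlinarith

lemma integrable_heat_moment {g : ℝ → ℝ} (hg : Integrable g) {k : ℝ → ℝ} (hk : Continuous k)
    {C : ℝ} (hC : ∀ s, |k s| ≤ C) : Integrable fun s => g s * k s :=
  hg.mul_bdd hk.aestronglyMeasurable (Eventually.of_forall hC)

/-- The first moment of the heat integrand. -/
noncomputable def heatMomentOne (g : ℝ → ℝ) (x t : ℝ) : ℝ :=
  ∫ s : ℝ, g s * ((s - x) * Real.exp (-((s - x) ^ 2 / (4 * t))))

/-- The second moment of the heat integrand. -/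
noncomputable def heatMomentTwo (g : ℝ → ℝ) (x t : ℝ) : ℝ :=
  ∫ s : ℝ, g s * ((s - x) ^ 2 * Real.exp (-((s - x) ^ 2 / (4 * t))))

lemma integrable_heat_zero {g : ℝ → ℝ} (hg : Integrable g)
    (x : ℝ) {t : ℝ} (ht : 0 < t) :
    Integrable fun s => g s * Real.exp (-((s - x) ^ 2 / (4 * t))) :=
  integrable_heat_moment hg (by fun_prop) (C := 1) fun s => by
    rw [Real.abs_exp]; exact exp_neg_sq_div_le_one _ ht

lemma integrable_heat_one {g : ℝ → ℝ} (hg : Integrable g)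
    (x : ℝ) {t : ℝ} (ht : 0 < t) :
    Integrable fun s => g s * ((s - x) * Real.exp (-((s - x) ^ 2 / (4 * t)))) :=
  integrable_heat_moment hg (by fun_prop) (C := 1 + 4 * t) fun s => by
    rw [abs_mul, Real.abs_exp]; exact abs_mul_exp_neg_le _ ht

lemma integrable_heat_two {g : ℝ → ℝ} (hg : Integrable g)
    (x : ℝ) {t : ℝ} (ht : 0 < t) :
    Integrable fun s => g s * ((s - x) ^ 2 * Real.exp (-((s - x) ^ 2 / (4 * t)))) :=
  integrable_heat_moment hg (by fun_prop) (C := 4 * t) fun s => by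
    rw [abs_mul, Real.abs_exp, abs_of_nonneg (sq_nonneg _)]; exact sq_mul_exp_neg_le _ ht

lemma hasDerivAt_heatIntegral_space {g : ℝ → ℝ} (hg : Integrable g)
    (x : ℝ) {t : ℝ} (ht : 0 < t) :
    HasDerivAt (fun y => heatIntegral g y t) ((2 * t)⁻¹ * heatMomentOne g x t) x := by
  rw [heatMomentOne, ← integral_const_mul]
  refine (hasDerivAt_integral_of_dominated_loc_of_deriv_le (s := univ)
    (bound := fun s => (2 * t)⁻¹ * (|g s| * (1 + 4 * t)))
    (F' := fun y s => (2 * t)⁻¹ * (g s * ((s - y) * Real.exp (-((s - y) ^ 2 / (4 * t))))))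
    univ_mem ?_ (integrable_heat_zero hg x ht) ?_ ?_ ?_ ?_).2
  · exact Eventually.of_forall fun y => (integrable_heat_zero hg y ht).aestronglyMeasurable
  · exact ((integrable_heat_one hg x ht).const_mul _).aestronglyMeasurable
  · refine Eventually.of_forall fun s y _ => ?_
    rw [Real.norm_eq_abs, abs_mul, abs_mul (g s), abs_mul (s - y), Real.abs_exp,
      abs_of_pos (by positivity : 0 < (2 * t)⁻¹)]
    gcongr
    exact abs_mul_exp_neg_le _ ht
  · exact (hg.abs.mul_const _).const_mul _
  · refine Eventually.of_forall fun s y _ => ?_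
    have h1 : HasDerivAt (fun y : ℝ => -((s - y) ^ 2 / (4 * t)))
        (-((2 : ℕ) * (s - y) ^ (2 - 1) * (-1) / (4 * t))) y :=
      ((((hasDerivAt_id y).const_sub s).pow 2).div_const _).neg
    refine (h1.exp.const_mul (g s)).congr_deriv ?_
    field_simp
    push_cast
    ring

lemma hasDerivAt_heatMomentOne_space {g : ℝ → ℝ} (hg : Integrable g)
    (x : ℝ) {t : ℝ} (ht : 0 < t) :
    HasDerivAt (fun y => heatMomentOne g y t)
      (-heatIntegral g x t + (2 * t)⁻¹ * heatMomentTwo g x t) x := by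
  have hneg : Integrable fun s => -(g s * Real.exp (-((s - x) ^ 2 / (4 * t)))) :=
    (integrable_heat_zero hg x ht).neg
  rw [heatMomentTwo, heatIntegral, ← integral_const_mul, ← integral_neg,
    ← integral_add hneg ((integrable_heat_two hg x ht).const_mul _)]
  refine (hasDerivAt_integral_of_dominated_loc_of_deriv_le (s := univ)
    (bound := fun s => |g s| * 1 + (2 * t)⁻¹ * (|g s| * (4 * t)))
    (F' := fun y s => -(g s * Real.exp (-((s - y) ^ 2 / (4 * t)))) +
      (2 * t)⁻¹ * (g s * ((s - y) ^ 2 * Real.exp (-((s - y) ^ 2 / (4 * t))))))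
    univ_mem ?_ (integrable_heat_one hg x ht) ?_ ?_ ?_ ?_).2
  · exact Eventually.of_forall fun y => (integrable_heat_one hg y ht).aestronglyMeasurable
  · exact ((integrable_heat_zero hg x ht).neg.add
      ((integrable_heat_two hg x ht).const_mul _)).aestronglyMeasurable
  · refine Eventually.of_forall fun s y _ => ?_
    refine (norm_add_le _ _).trans ?_
    rw [norm_neg, Real.norm_eq_abs, Real.norm_eq_abs, abs_mul, abs_mul, abs_mul (g s),
      abs_mul ((s - y) ^ 2), Real.abs_exp, abs_of_nonneg (sq_nonneg (s - y)),
      abs_of_pos (by positivity : 0 < (2 * t)⁻¹)]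
    gcongr _ * ?_ + _ * (_ * ?_)
    · exact exp_neg_sq_div_le_one _ ht
    · exact sq_mul_exp_neg_le _ ht
  · exact (hg.abs.mul_const _).add ((hg.abs.mul_const _).const_mul _)
  · refine Eventually.of_forall fun s y _ => ?_
    have h0 : HasDerivAt (fun y : ℝ => s - y) (-1) y := (hasDerivAt_id y).const_sub s
    have h1 : HasDerivAt (fun y : ℝ => -((s - y) ^ 2 / (4 * t)))
        (-((2 : ℕ) * (s - y) ^ (2 - 1) * (-1) / (4 * t))) y :=
      ((h0.pow 2).div_const _).neg
    refine ((h0.mul h1.exp).const_mul (g s)).congr_deriv ?_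
    field_simp
    push_cast
    ring

lemma hasDerivAt_heatIntegral_time {g : ℝ → ℝ} (hg : Integrable g)
    (x : ℝ) {t : ℝ} (ht : 0 < t) :
    HasDerivAt (fun r => heatIntegral g x r) ((4 * t ^ 2)⁻¹ * heatMomentTwo g x t) t := by
  rw [heatMomentTwo, ← integral_const_mul]
  -- Staying above `t / 2` keeps the factor `1 / r` in the differentiated kernel below `2 / t`.
  have hmem : Ioi (t / 2) ∈ 𝓝 t := Ioi_mem_nhds (by linarith)
  refine (hasDerivAt_integral_of_dominated_loc_of_deriv_le (s := Ioi (t / 2))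
    (bound := fun s => |g s| * (2 / t))
    (F' := fun r s => (4 * r ^ 2)⁻¹ * (g s * ((s - x) ^ 2 * Real.exp (-((s - x) ^ 2 / (4 * r))))))
    hmem ?_ (integrable_heat_zero hg x ht) ?_ ?_ ?_ ?_).2
  · filter_upwards [hmem] with r hr
    exact (integrable_heat_zero hg x (by rw [mem_Ioi] at hr; linarith)).aestronglyMeasurable
  · exact ((integrable_heat_two hg x ht).const_mul _).aestronglyMeasurable
  · refine Eventually.of_forall fun s r hr => ?_
    rw [mem_Ioi] at hr
    have hr0 : 0 < r := by linarith
    rw [Real.norm_eq_abs, abs_mul, abs_mul (g s), abs_mul ((s - x) ^ 2), Real.abs_exp,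
      abs_of_nonneg (sq_nonneg (s - x)), abs_of_pos (by positivity : 0 < (4 * r ^ 2)⁻¹)]
    calc (4 * r ^ 2)⁻¹ * (|g s| * ((s - x) ^ 2 * Real.exp (-((s - x) ^ 2 / (4 * r)))))
        ≤ (4 * r ^ 2)⁻¹ * (|g s| * (4 * r)) := by
          gcongr _ * (_ * ?_)
          exact sq_mul_exp_neg_le _ hr0
      _ = |g s| * (1 / r) := by field_simp
      _ ≤ |g s| * (2 / t) := by
          gcongr ?_ * ?_
          rw [div_le_div_iff₀ hr0 ht]; linarith
  · exact hg.abs.mul_const _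
  · refine Eventually.of_forall fun s r hr => ?_
    rw [mem_Ioi] at hr
    have hr0 : r ≠ 0 := by linarith
    have h1 : HasDerivAt (fun r : ℝ => -((s - x) ^ 2 / 4 * r⁻¹))
        (-((s - x) ^ 2 / 4 * (-(r ^ 2)⁻¹))) r :=
      ((hasDerivAt_inv hr0).const_mul _).neg
    have h2 : (fun r : ℝ => -((s - x) ^ 2 / (4 * r))) = fun r => -((s - x) ^ 2 / 4 * r⁻¹) := by
      funext r
      rw [← div_eq_mul_inv, div_div]
    rw [← h2] at h1
    refine (h1.exp.const_mul (g s)).congr_deriv ?_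
    field_simp

/-- The heat flow of an integrable function solves the heat equation. -/
theorem exists_hasParabolicDeriv_heatFlow {g : ℝ → ℝ} (hg : Integrable g) :
    ∃ D Hx : ℝ → ℝ → ℝ, HasParabolicDeriv (heatFlow g) D Hx D := by
  refine ⟨fun x t => (2 * √Real.pi)⁻¹ * (t ^ (-(1 / 2) : ℝ) *
      ((2 * t)⁻¹ * (-heatIntegral g x t + (2 * t)⁻¹ * heatMomentTwo g x t))),
    fun x t => (2 * √Real.pi)⁻¹ * (t ^ (-(1 / 2) : ℝ) * ((2 * t)⁻¹ * heatMomentOne g x t)),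
    ⟨fun x t ht => ?_, fun x t ht => ?_, fun x t ht => ?_⟩⟩
  · have h1 : HasDerivAt (fun r : ℝ => (2 * √Real.pi)⁻¹ *
        (r ^ (-(1 / 2) : ℝ) * heatIntegral g x r)) _ t :=
      ((Real.hasDerivAt_rpow_const (Or.inl ht.ne')).mul
        (hasDerivAt_heatIntegral_time hg x ht)).const_mul _
    refine (h1.congr_of_eventuallyEq ?_).congr_deriv ?_
    · filter_upwards [Ioi_mem_nhds ht] with r hr using heatFlow_eq g x hr
    · rw [Real.rpow_sub_one ht.ne']
      field_simp
      ring
  · have h1 := ((hasDerivAt_heatIntegral_space hg x ht).const_mul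
      (t ^ (-(1 / 2) : ℝ))).const_mul (2 * √Real.pi)⁻¹
    exact h1.congr_of_eventuallyEq (Eventually.of_forall fun y => heatFlow_eq g y ht)
  · exact (((hasDerivAt_heatMomentOne_space hg x ht).const_mul _).const_mul _).const_mul _

lemma heatIntegral_pos {g : ℝ → ℝ} (hg : Integrable g) (hc : Continuous g) (h0 : ∀ x, 0 ≤ g x)
    (hne : ∃ x, g x ≠ 0) (x : ℝ) {t : ℝ} (ht : 0 < t) : 0 < heatIntegral g x t := by
  obtain ⟨a, ha⟩ := hne
  refine integral_pos_of_integrable_nonneg_nonzero (x := a) (by fun_prop)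
    (integrable_heat_zero hg x ht) (fun s => mul_nonneg (h0 s) (Real.exp_pos _).le) ?_
  exact mul_ne_zero ha (Real.exp_pos _).ne'


lemma hasParabolicDeriv_mul_time (c : ℝ) :
    HasParabolicDeriv (fun _ t => c * t) (fun _ _ => c) (fun _ _ => 0) (fun _ _ => 0) where
  time _ t _ := by simpa using (hasDerivAt_id t).const_mul c
  space x _ _ := hasDerivAt_const x _
  space₂ x _ _ := hasDerivAt_const x _

lemma reaction_nonneg (p u : ℝ) : 0 ≤ reaction p u := by
  unfold reaction
  split_ifs with h
  · exact Real.rpow_nonneg h p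
  · exact le_rfl

/-! ### Basic properties of the initial data. -/

namespace IsInitialDatum

lemma eq_zero {u₀ : ℝ → ℝ} (h : IsInitialDatum u₀)
    {x : ℝ} (hx : x ∉ Icc (-1 : ℝ) 1) : u₀ x = 0 :=
  image_eq_zero_of_notMem_tsupport fun hx' => hx (h.support_subset hx')

lemma hasCompactSupport {u₀ : ℝ → ℝ} (h : IsInitialDatum u₀) :
    HasCompactSupport u₀ :=
  isCompact_Icc.of_isClosed_subset (isClosed_tsupport u₀) h.support_subset

lemma abs_le_supNorm {u₀ : ℝ → ℝ} (h : IsInitialDatum u₀)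
    (x : ℝ) : |u₀ x| ≤ supNorm u₀ := by
  obtain ⟨C, hC⟩ := h.hasCompactSupport.exists_bound_of_continuous h.continuous
  exact le_ciSup (f := fun x => |u₀ x|) ⟨C, by rintro _ ⟨y, rfl⟩; exact hC y⟩ x

lemma supNorm_nonneg {u₀ : ℝ → ℝ} (h : IsInitialDatum u₀) :
    0 ≤ supNorm u₀ := (abs_nonneg _).trans (h.abs_le_supNorm 0)

lemma integrable {u₀ : ℝ → ℝ} (h : IsInitialDatum u₀) :
    Integrable u₀ := h.continuous.integrable_of_hasCompactSupport h.hasCompactSupport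

lemma continuous_rpow {u₀ : ℝ → ℝ} (h : IsInitialDatum u₀)
    {r : ℝ} (hr : 0 < r) : Continuous fun x => u₀ x ^ r :=
  h.continuous.rpow_const fun _ => Or.inr hr.le

lemma integrable_rpow {u₀ : ℝ → ℝ} (h : IsInitialDatum u₀)
    {r : ℝ} (hr : 0 < r) : Integrable fun x => u₀ x ^ r :=
  (h.continuous_rpow hr).integrable_of_hasCompactSupport
    (h.hasCompactSupport.comp_left (g := fun y : ℝ => y ^ r) (Real.zero_rpow hr.ne'))

lemma abs_rpow_le {u₀ : ℝ → ℝ} (h : IsInitialDatum u₀)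
    {r : ℝ} (hr : 0 < r) (x : ℝ) : |u₀ x ^ r| ≤ supNorm u₀ ^ r := by
  rw [abs_of_nonneg (Real.rpow_nonneg (h.nonneg x) r)]
  exact Real.rpow_le_rpow (h.nonneg x) ((le_abs_self _).trans (h.abs_le_supNorm x)) hr.le

lemma exists_rpow_ne_zero {u₀ : ℝ → ℝ} (h : IsInitialDatum u₀)
    (r : ℝ) : ∃ x, u₀ x ^ r ≠ 0 := by
  obtain ⟨x, hx⟩ := h.nontrivial
  exact ⟨x, (Real.rpow_pos_of_pos ((h.nonneg x).lt_of_ne' hx) r).ne'⟩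

lemma heatFlow_pos {u₀ : ℝ → ℝ} (h : IsInitialDatum u₀)
    (x : ℝ) {t : ℝ} (ht : 0 < t) : 0 < heatFlow u₀ x t := by
  have := heatIntegral_pos h.integrable h.continuous h.nonneg h.nontrivial x ht
  have hpi := Real.pi_pos
  rw [heatFlow_eq _ _ ht]
  positivity

lemma heatFlow_rpow_pos {u₀ : ℝ → ℝ} (h : IsInitialDatum u₀)
    {r : ℝ} (hr : 0 < r) (x : ℝ) {t : ℝ} (ht : 0 < t) :
    0 < heatFlow (fun y => u₀ y ^ r) x t := by
  have := heatIntegral_pos (h.integrable_rpow hr) (h.continuous_rpow hr)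
    (fun y => Real.rpow_nonneg (h.nonneg y) r) (h.exists_rpow_ne_zero r) x ht
  have hpi := Real.pi_pos
  rw [heatFlow_eq _ _ ht]
  positivity

lemma intervalIntegral_eq {u₀ : ℝ → ℝ} (h : IsInitialDatum u₀)
    (k : ℝ → ℝ) :
    ∫ s in (-1 : ℝ)..1, u₀ s * k s = ∫ s, u₀ s * k s := by
  rw [intervalIntegral.integral_of_le (by norm_num), ← integral_Icc_eq_integral_Ioc]
  refine setIntegral_eq_integral_of_forall_compl_eq_zero fun s hs => ?_
  rw [h.eq_zero hs, zero_mul]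

end IsInitialDatum

/-! ### Comparison of transformed solutions with heat flows. -/

namespace IsGlobalSolution

lemma hasParabolicDeriv {p : ℝ} {u₀ : ℝ → ℝ} {u : ℝ → ℝ → ℝ} (hu : IsGlobalSolution p u₀ u) :
    HasParabolicDeriv u (fun x t => deriv (fun s => u x s) t)
    (fun x t => deriv (fun y => u y t) x) (fun x t => deriv (deriv (fun y => u y t)) x) where
  time x t ht := (hu.isC21.differentiable_t x t ht).hasDerivAt
  space x t ht := (hu.isC21.differentiable_x x t ht).hasDerivAt
  space₂ x t ht := (hu.isC21.differentiable_xx x t ht).hasDerivAt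

/-- Discarding the nonnegative reaction leaves a heat supersolution. This yields strict positivity
of `u`, without which its real powers could not be differentiated. -/
lemma heatFlow_le {p : ℝ} {u₀ : ℝ → ℝ} {u : ℝ → ℝ → ℝ} (hu : IsGlobalSolution p u₀ u)
    (hu₀ : IsInitialDatum u₀)
    (x : ℝ) {t : ℝ} (ht : 0 ≤ t) : heatFlow u₀ x t ≤ u x t := by
  obtain ⟨D, Hx, hD⟩ := exists_hasParabolicDeriv_heatFlow hu₀.integrable
  rw [← sub_nonneg]
  refine heat_minimum_principle
    (hu.continuousOn.sub (continuous_heatFlow hu₀.continuous hu₀.abs_le_supNorm).continuousOn)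
    (hu.hasParabolicDeriv.sub hD) ?_ ?_ ?_ x t ht
  · intro x t ht
    have := hu.equation x t ht
    have := reaction_nonneg p (u x t)
    linarith
  · intro T hT
    obtain ⟨M, hM⟩ := hu.bounded T hT
    refine ⟨M + supNorm u₀, fun x t h0 h1 => ?_⟩
    have h2 := (abs_le.1 (hM x t h0 h1)).1
    have h3 := (abs_le.1 (abs_heatFlow_le hu₀.abs_le_supNorm x t)).2
    linarith
  · intro x
    rw [heatFlow_zero, hu.initial, sub_self]

lemma pos {p : ℝ} {u₀ : ℝ → ℝ} {u : ℝ → ℝ → ℝ} (hu : IsGlobalSolution p u₀ u)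
    (hu₀ : IsInitialDatum u₀)
    (x : ℝ) {t : ℝ} (ht : 0 < t) : 0 < u x t :=
  (hu₀.heatFlow_pos x ht).trans_le (hu.heatFlow_le hu₀ x ht.le)

lemma nonneg {p : ℝ} {u₀ : ℝ → ℝ} {u : ℝ → ℝ → ℝ} (hu : IsGlobalSolution p u₀ u)
    (hu₀ : IsInitialDatum u₀)
    (x : ℝ) {t : ℝ} (ht : 0 ≤ t) : 0 ≤ u x t := by
  rcases ht.eq_or_lt with rfl | ht
  · rw [hu.initial]; exact hu₀.nonneg x
  · exact (hu.pos hu₀ x ht).le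

lemma equation_rpow {p : ℝ} {u₀ : ℝ → ℝ} {u : ℝ → ℝ → ℝ} (hu : IsGlobalSolution p u₀ u)
    (hu₀ : IsInitialDatum u₀)
    (x : ℝ) {t : ℝ} (ht : 0 < t) :
    deriv (fun s => u x s) t = deriv (deriv (fun y => u y t)) x + u x t ^ p := by
  rw [hu.equation x t ht, reaction, if_pos (hu.pos hu₀ x ht).le]

/-- `u^(1-p)` dominates the solution of `z_t = z_xx + (1 - p)` with the same initial values. -/
lemma add_heatFlow_rpow_le {p : ℝ} {u₀ : ℝ → ℝ} {u : ℝ → ℝ → ℝ} (hu : IsGlobalSolution p u₀ u)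
    (hu₀ : IsInitialDatum u₀) (hp0 : 0 < p) (hp1 : p < 1)
    (x : ℝ) {t : ℝ} (ht : 0 ≤ t) :
    (1 - p) * t + heatFlow (fun y => u₀ y ^ (1 - p)) x t ≤ u x t ^ (1 - p) := by
  have hq : 0 < 1 - p := by linarith
  obtain ⟨D, Hx, hD⟩ := exists_hasParabolicDeriv_heatFlow (hu₀.integrable_rpow hq)
  have key : 0 ≤ u x t ^ (1 - p) - (1 - p) * t - heatFlow (fun y => u₀ y ^ (1 - p)) x t := by
    refine heat_minimum_principle
      (((hu.continuousOn.rpow_const fun _ _ => Or.inr hq.le).sub (by fun_prop)).sub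
        (continuous_heatFlow (hu₀.continuous_rpow hq) (hu₀.abs_rpow_le hq)).continuousOn)
      (((hu.hasParabolicDeriv.rpow (fun x t ht => hu.pos hu₀ x ht) (1 - p)).sub
        (hasParabolicDeriv_mul_time (1 - p))).sub hD) ?_ ?_ ?_ x t ht
    · intro x t ht
      have hpos := hu.pos hu₀ x ht
      simp only [hu.equation_rpow hu₀ x ht]
      set a := deriv (deriv fun y => u y t) x
      set b := deriv (fun y => u y t) x
      have h1 : u x t ^ p * u x t ^ (1 - p - 1) = 1 := by
        rw [← Real.rpow_add hpos]; simp
      have h2 : 0 < u x t ^ (1 - p - 1 - 1) := Real.rpow_pos_of_pos hpos _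
      -- This gradient term is all that remains of `z_t - z_xx - (1-p)` for `z = u^(1-p)`.
      have h3 : 0 ≤ b ^ 2 * (1 - p) * p * u x t ^ (1 - p - 1 - 1) := by positivity
      have h4 : (a + u x t ^ p) * (1 - p) * u x t ^ (1 - p - 1) =
          a * (1 - p) * u x t ^ (1 - p - 1) + (1 - p) := by
        linear_combination (1 - p) * h1
      rw [h4]
      nlinarith
    · intro T hT
      refine ⟨(1 - p) * T + supNorm u₀ ^ (1 - p), fun x t h0 h1 => ?_⟩
      have h2 := Real.rpow_nonneg (hu.nonneg hu₀ x h0) (1 - p)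
      have h3 := (abs_le.1 (abs_heatFlow_le (hu₀.abs_rpow_le hq) x t)).2
      have h4 : (1 - p) * t ≤ (1 - p) * T := by gcongr
      linarith
    · intro x
      rw [heatFlow_zero, hu.initial]
      simp
  linarith

lemma mul_time_le_rpow {p : ℝ} {u₀ : ℝ → ℝ} {u : ℝ → ℝ → ℝ} (hu : IsGlobalSolution p u₀ u)
    (hu₀ : IsInitialDatum u₀) (hp0 : 0 < p) (hp1 : p < 1)
    (x : ℝ) {t : ℝ} (ht : 0 ≤ t) : (1 - p) * t ≤ u x t ^ (1 - p) := by
  rcases ht.eq_or_lt with rfl | h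
  · rw [mul_zero]; exact Real.rpow_nonneg (hu.nonneg hu₀ x le_rfl) _
  · have := hu.add_heatFlow_rpow_le hu₀ hp0 hp1 x ht
    have := hu₀.heatFlow_rpow_pos (by linarith : 0 < 1 - p) x h
    linarith

lemma mul_time_lt_rpow {p : ℝ} {u₀ : ℝ → ℝ} {u : ℝ → ℝ → ℝ} (hu : IsGlobalSolution p u₀ u)
    (hu₀ : IsInitialDatum u₀) (hp0 : 0 < p) (hp1 : p < 1)
    (x : ℝ) {t : ℝ} (ht : 0 < t) : (1 - p) * t < u x t ^ (1 - p) := by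
  have := hu.add_heatFlow_rpow_le hu₀ hp0 hp1 x ht.le
  have := hu₀.heatFlow_rpow_pos (by linarith : 0 < 1 - p) x ht
  linarith

/-- Undoing the flow of the reaction equation turns the solution into a subsolution of the heat equation. -/
lemma rpow_sub_rpow_le_heatFlow {p : ℝ} {u₀ : ℝ → ℝ} {u : ℝ → ℝ → ℝ} (hu : IsGlobalSolution p u₀ u)
    (hu₀ : IsInitialDatum u₀) (hp0 : 0 < p) (hp1 : p < 1)
    (x : ℝ) {t : ℝ} (ht : 0 ≤ t) :
    (u x t ^ (1 - p) - (1 - p) * t) ^ (1 / (1 - p)) ≤ heatFlow u₀ x t := by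
  have hq : 0 < 1 - p := by linarith
  have hm : 0 < 1 / (1 - p) := by positivity
  obtain ⟨D, Hx, hD⟩ := exists_hasParabolicDeriv_heatFlow hu₀.integrable
  rw [← sub_nonneg]
  refine heat_minimum_principle
    ((continuous_heatFlow hu₀.continuous hu₀.abs_le_supNorm).continuousOn.sub
      (((hu.continuousOn.rpow_const fun _ _ => Or.inr hq.le).sub (by fun_prop)).rpow_const
        fun _ _ => Or.inr hm.le))
    (hD.sub (((hu.hasParabolicDeriv.rpow (fun x t ht => hu.pos hu₀ x ht) (1 - p)).sub
        (hasParabolicDeriv_mul_time (1 - p))).rpow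
          (fun x t ht => sub_pos.2 (hu.mul_time_lt_rpow hu₀ hp0 hp1 x ht)) (1 / (1 - p))))
    ?_ ?_ ?_ x t ht
  · intro x t ht
    have hpos := hu.pos hu₀ x ht
    have hζ := sub_pos.2 (hu.mul_time_lt_rpow hu₀ hp0 hp1 x ht)
    simp only [hu.equation_rpow hu₀ x ht, sub_zero]
    set a := deriv (deriv fun y => u y t) x
    set b := deriv (fun y => u y t) x
    set ζ := u x t ^ (1 - p) - (1 - p) * t with hζdef
    have h1 : u x t ^ p * u x t ^ (1 - p - 1) = 1 := by
      rw [← Real.rpow_add hpos]; simp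
    have h2 : 0 < u x t ^ (1 - p - 1) := Real.rpow_pos_of_pos hpos _
    have h3 : u x t ^ (1 - p - 1 - 1) * u x t ^ (1 - p) =
        u x t ^ (1 - p - 1) * u x t ^ (1 - p - 1) := by
      rw [← Real.rpow_add hpos, ← Real.rpow_add hpos]; ring_nf
    have h4 : 0 < ζ ^ (1 / (1 - p) - 1 - 1) := Real.rpow_pos_of_pos hζ _
    have h5 : ζ ^ (1 / (1 - p) - 1) = ζ ^ (1 / (1 - p) - 1 - 1) * ζ := by
      rw [← Real.rpow_add_one hζ.ne']; ring_nf
    -- Subtracting `(1-p)t` only shrinks `ζ` below `u^(1-p)`; this fixes the sign of the gradient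
    -- term.
    have h6 : u x t ^ (1 - p - 1 - 1) * ζ ≤ u x t ^ (1 - p - 1) * u x t ^ (1 - p - 1) := by
      rw [← h3]
      have : ζ ≤ u x t ^ (1 - p) := by rw [hζdef]; nlinarith
      gcongr
    have h7 : (a + u x t ^ p) * (1 - p) * u x t ^ (1 - p - 1) =
        a * (1 - p) * u x t ^ (1 - p - 1) + (1 - p) := by
      linear_combination (1 - p) * h1
    rw [h5, h7]
    set A := u x t ^ (1 - p - 1)
    set B := u x t ^ (1 - p - 1 - 1)
    set Z := ζ ^ (1 / (1 - p) - 1 - 1)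
    have h8 : 0 ≤ Z * p * b ^ 2 * (A * A - B * ζ) :=
      mul_nonneg (by positivity) (sub_nonneg.2 h6)
    -- The left side is `v_xx - v_t` for `v = ζ^(1/(1-p))`: the reaction cancels and a multiple of
    -- `u_x²` remains.
    have h9 : (a * (1 - p) * A + b * (1 - p) * (b * (1 - p - 1) * B)) * (1 / (1 - p)) * (Z * ζ) +
        b * (1 - p) * A * (1 / (1 - p)) * (b * (1 - p) * A * (1 / (1 - p) - 1) * Z) -
        (a * (1 - p) * A + (1 - p) - (1 - p)) * (1 / (1 - p)) * (Z * ζ) =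
        Z * p * b ^ 2 * (A * A - B * ζ) := by
      field_simp
      ring
    linarith
  · intro T hT
    obtain ⟨M, hM⟩ := hu.bounded T hT
    refine ⟨supNorm u₀ + M, fun x t h0 h1 => ?_⟩
    have h2 := (abs_le.1 (abs_heatFlow_le hu₀.abs_le_supNorm x t)).1
    have h3 : (u x t ^ (1 - p) - (1 - p) * t) ^ (1 / (1 - p)) ≤ u x t := by
      have h5 := hu.nonneg hu₀ x h0
      calc _ ≤ (u x t ^ (1 - p)) ^ (1 / (1 - p)) := by
            refine Real.rpow_le_rpow (sub_nonneg.2 (hu.mul_time_le_rpow hu₀ hp0 hp1 x h0)) ?_ hm.le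
            have : 0 ≤ (1 - p) * t := by positivity
            linarith
        _ = u x t := by rw [one_div, Real.rpow_rpow_inv h5 hq.ne']
    have h4 := (abs_le.1 (hM x t h0 h1)).2
    linarith
  · intro x
    rw [heatFlow_zero, hu.initial, mul_zero, sub_zero, one_div,
      Real.rpow_rpow_inv (hu₀.nonneg x) hq.ne', sub_self]

end IsGlobalSolution


/-! ### Tangent inequalities and Gaussian decay of the excess. -/

/-- Tangent line bound for the concave power `y ^ p`. -/
lemma rpow_le_tangent {p a b : ℝ} (hp0 : 0 ≤ p) (hp1 : p ≤ 1) (ha : 0 ≤ a) (hb : 0 < b) :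
    a ^ p ≤ b ^ p + p * b ^ (p - 1) * (a - b) := by
  have hs : -1 ≤ a / b - 1 := by linarith [div_nonneg ha hb.le]
  have h := rpow_one_add_le_one_add_mul_self hs hp0 hp1
  rw [add_sub_cancel, Real.div_rpow ha hb.le, div_le_iff₀ (Real.rpow_pos_of_pos hb p)] at h
  refine h.trans_eq ?_
  rw [Real.rpow_sub_one hb.ne']
  field_simp

/-- Tangent line bound for the convex power `y ^ m`. -/
lemma tangent_le_rpow {m a b : ℝ} (hm : 1 ≤ m) (ha : 0 ≤ a) (hb : 0 < b) :
    b ^ m + m * b ^ (m - 1) * (a - b) ≤ a ^ m := by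
  have hs : -1 ≤ a / b - 1 := by linarith [div_nonneg ha hb.le]
  have h := one_add_mul_self_le_rpow_one_add hs hm
  rw [add_sub_cancel, Real.div_rpow ha hb.le, le_div_iff₀ (Real.rpow_pos_of_pos hb m)] at h
  refine le_trans (le_of_eq ?_) h
  rw [Real.rpow_sub_one hb.ne']
  field_simp

lemma cPlus_eq (x t p : ℝ) (u₀ : ℝ → ℝ) : cPlus x t p u₀ =
    (1 - p) ^ ((1 - 2 * p) / (1 - p)) / √(2 * Real.pi * (1 - p)) *
      heatIntegral (excess p u₀) x (t - 1) := rfl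

namespace IsInitialDatum

lemma heatOne_eq {u₀ : ℝ → ℝ} (h : IsInitialDatum u₀)
    (s : ℝ) : heatOne u₀ s = heatFlow u₀ s 1 := by
  rw [heatOne, h.intervalIntegral_eq, heatFlow_eq _ _ one_pos, Real.one_rpow, one_mul,
    heatIntegral, one_div]
  congr 2
  funext w
  ring_nf

lemma heatOne_pos {u₀ : ℝ → ℝ} (h : IsInitialDatum u₀)
    (s : ℝ) : 0 < heatOne u₀ s := by
  rw [h.heatOne_eq]; exact h.heatFlow_pos s one_pos

lemma continuous_heatOne {u₀ : ℝ → ℝ} (h : IsInitialDatum u₀) :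
    Continuous (heatOne u₀) := by
  rw [funext h.heatOne_eq]
  exact (continuous_heatFlow h.continuous h.abs_le_supNorm).comp (by fun_prop : Continuous
    fun s : ℝ => (s, (1 : ℝ)))

lemma heatOne_le {u₀ : ℝ → ℝ} (h : IsInitialDatum u₀)
    (s : ℝ) : heatOne u₀ s ≤ supNorm u₀ := by
  rw [h.heatOne_eq]
  exact (le_abs_self _).trans (abs_heatFlow_le h.abs_le_supNorm s 1)

/-- For `|w| ≤ 1`, the identity `(w-s)²/4 + w²/4 - s²/8 = (2w-s)²/8` gives `-(w-s)²/4 ≤ 1/4 - s²/8`.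
-/
lemma exists_heatOne_le_gaussian {u₀ : ℝ → ℝ} (h : IsInitialDatum u₀) :
    ∃ C, 0 ≤ C ∧ ∀ s, heatOne u₀ s ≤ C * Real.exp (-(1 / 8) * s ^ 2) := by
  have hpi := Real.pi_pos
  have hI : 0 ≤ ∫ w, u₀ w := integral_nonneg h.nonneg
  refine ⟨(2 * √Real.pi)⁻¹ * (Real.exp (1 / 4) * ∫ w, u₀ w), by positivity, fun s => ?_⟩
  have hle : heatIntegral u₀ s 1 ≤
      ∫ w, u₀ w * (Real.exp (1 / 4) * Real.exp (-(1 / 8) * s ^ 2)) := by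
    refine integral_mono (integrable_heat_zero h.integrable s one_pos)
      (h.integrable.mul_const _) fun w => ?_
    simp only
    by_cases hw : w ∈ Icc (-1 : ℝ) 1
    · refine mul_le_mul_of_nonneg_left ?_ (h.nonneg w)
      rw [← Real.exp_add]
      refine Real.exp_le_exp.2 ?_
      have : w ^ 2 ≤ 1 := by nlinarith [hw.1, hw.2]
      nlinarith [sq_nonneg (2 * w - s)]
    · rw [h.eq_zero hw]; simp
  rw [integral_mul_const] at hle
  rw [h.heatOne_eq, heatFlow_eq _ _ one_pos, Real.one_rpow, one_mul]
  calc _ ≤ (2 * √Real.pi)⁻¹ * ((∫ w, u₀ w) * (Real.exp (1 / 4) * Real.exp (-(1 / 8) * s ^ 2))) := by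
        gcongr
    _ = _ := by ring

lemma cMinus_eq {u₀ : ℝ → ℝ} (h : IsInitialDatum u₀)
    (x t p : ℝ) : cMinus x t p u₀ =
    (1 + supNorm u₀)⁻¹ / (2 * √(Real.pi * (1 - p))) * heatIntegral u₀ x t := by
  rw [cMinus, h.intervalIntegral_eq, heatIntegral]

lemma excess_pos {u₀ : ℝ → ℝ} (h : IsInitialDatum u₀) {p : ℝ} (hp1 : p < 1)
    (s : ℝ) : 0 < excess p u₀ s := by
  have hq : 0 < 1 - p := by linarith
  have := Real.rpow_pos_of_pos (h.heatOne_pos s) (1 - p)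
  exact sub_pos.2 (Real.rpow_lt_rpow hq.le (by linarith) (by positivity))

lemma continuous_excess {u₀ : ℝ → ℝ} (h : IsInitialDatum u₀) {p : ℝ} (hp1 : p < 1) :
    Continuous (excess p u₀) := by
  have hq : 0 < 1 - p := by linarith
  have hm : 0 ≤ 1 / (1 - p) := by positivity
  exact ((continuous_const.add (h.continuous_heatOne.rpow_const fun _ => Or.inr hq.le)).rpow_const
    fun _ => Or.inr hm).sub continuous_const

/-- By convexity the excess is at most a constant times `Δ^(1-p)`, and a power of a Gaussian is a
Gaussian. This makes `c₊` a convergent integral. -/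
lemma exists_excess_le_gaussian {u₀ : ℝ → ℝ} (h : IsInitialDatum u₀) {p : ℝ} (hp1 : p < 1) (hp0 : 0 < p) :
    ∃ C, 0 ≤ C ∧ ∀ s, excess p u₀ s ≤ C * Real.exp (-((1 - p) / 8) * s ^ 2) := by
  have hq : 0 < 1 - p := by linarith
  have hm : 1 ≤ 1 / (1 - p) := by rw [le_div_iff₀ hq]; linarith
  obtain ⟨C, hC0, hC⟩ := h.exists_heatOne_le_gaussian
  have hN := Real.rpow_nonneg h.supNorm_nonneg (1 - p)
  refine ⟨1 / (1 - p) * ((1 - p) + supNorm u₀ ^ (1 - p)) ^ (1 / (1 - p) - 1) * C ^ (1 - p),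
    by positivity, fun s => ?_⟩
  set y := heatOne u₀ s ^ (1 - p) with hy
  have hy0 : 0 < y := Real.rpow_pos_of_pos (h.heatOne_pos s) _
  have hyN : y ≤ supNorm u₀ ^ (1 - p) :=
    Real.rpow_le_rpow (h.heatOne_pos s).le (h.heatOne_le s) hq.le
  have hyC : y ≤ C ^ (1 - p) * Real.exp (-((1 - p) / 8) * s ^ 2) := by
    refine (Real.rpow_le_rpow (h.heatOne_pos s).le (hC s) hq.le).trans_eq ?_
    rw [Real.mul_rpow hC0 (Real.exp_pos _).le, ← Real.exp_mul]
    ring_nf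
  have htan := tangent_le_rpow hm hq.le (by linarith : 0 < (1 - p) + y)
  calc excess p u₀ s = ((1 - p) + y) ^ (1 / (1 - p)) - (1 - p) ^ (1 / (1 - p)) := rfl
    _ ≤ 1 / (1 - p) * ((1 - p) + y) ^ (1 / (1 - p) - 1) * y := by linarith
    _ ≤ 1 / (1 - p) * ((1 - p) + supNorm u₀ ^ (1 - p)) ^ (1 / (1 - p) - 1) *
        (C ^ (1 - p) * Real.exp (-((1 - p) / 8) * s ^ 2)) := by
      have : 0 ≤ 1 / (1 - p) - 1 := by linarith
      gcongr
    _ = _ := by ring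

lemma integrable_excess {u₀ : ℝ → ℝ} (h : IsInitialDatum u₀) {p : ℝ} (hp1 : p < 1) (hp0 : 0 < p) :
    Integrable (excess p u₀) := by
  obtain ⟨C, hC0, hC⟩ := h.exists_excess_le_gaussian hp1 hp0
  refine ((integrable_exp_neg_mul_sq (b := (1 - p) / 8) (by linarith)).const_mul C).mono'
    (h.continuous_excess hp1).aestronglyMeasurable (Eventually.of_forall fun s => ?_)
  rw [Real.norm_eq_abs, abs_of_pos (h.excess_pos hp1 s)]
  exact hC s

lemma exists_abs_excess_le {u₀ : ℝ → ℝ} (h : IsInitialDatum u₀) {p : ℝ} (hp1 : p < 1) (hp0 : 0 < p) :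
    ∃ C, ∀ s, |excess p u₀ s| ≤ C := by
  obtain ⟨C, hC0, hC⟩ := h.exists_excess_le_gaussian hp1 hp0
  refine ⟨C, fun s => ?_⟩
  rw [abs_of_pos (h.excess_pos hp1 s)]
  refine (hC s).trans (mul_le_of_le_one_right hC0 (Real.exp_le_one_iff.2 ?_))
  nlinarith [sq_nonneg s, mul_nonneg (by linarith : 0 ≤ 1 - p) (sq_nonneg s)]

end IsInitialDatum

/-- The heat integral is bounded by the total mass. -/
lemma heatIntegral_le {g : ℝ → ℝ} (hg : Integrable g) (h0 : ∀ x, 0 ≤ g x) (x : ℝ) {t : ℝ}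
    (ht : 0 < t) : heatIntegral g x t ≤ ∫ s, g s :=
  integral_mono (integrable_heat_zero hg x ht) hg fun s =>
    mul_le_of_le_one_right (h0 s) (exp_neg_sq_div_le_one _ ht)

/-! ### Deviation from the homogeneous solution. -/

namespace IsGlobalSolution

/-- The spatially homogeneous solution lies below `u`. -/
lemma homogeneous_le {p : ℝ} {u₀ : ℝ → ℝ} {u : ℝ → ℝ → ℝ} (hu : IsGlobalSolution p u₀ u)
    (hu₀ : IsInitialDatum u₀) (hp0 : 0 < p) (hp1 : p < 1)
    (x : ℝ) {t : ℝ} (ht : 0 ≤ t) :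
    ((1 - p) * t) ^ (1 / (1 - p)) ≤ u x t := by
  have hq : 0 < 1 - p := by linarith
  have h := Real.rpow_le_rpow (by positivity) (hu.mul_time_le_rpow hu₀ hp0 hp1 x ht)
    (by positivity : 0 ≤ 1 / (1 - p))
  rwa [one_div, Real.rpow_rpow_inv (hu.nonneg hu₀ x ht) hq.ne', ← one_div] at h

/-- Solving the subsolution bound at `t = 1` for `u` produces exactly the formula for `𝓔`. -/
lemma sub_le_excess {p : ℝ} {u₀ : ℝ → ℝ} {u : ℝ → ℝ → ℝ} (hu : IsGlobalSolution p u₀ u)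
    (hu₀ : IsInitialDatum u₀) (hp0 : 0 < p) (hp1 : p < 1)
    (x : ℝ) : u x 1 - (1 - p) ^ (1 / (1 - p)) ≤ excess p u₀ x := by
  have hq : 0 < 1 - p := by linarith
  have h := hu.rpow_sub_rpow_le_heatFlow hu₀ hp0 hp1 x zero_le_one
  have hζ := (hu.mul_time_lt_rpow hu₀ hp0 hp1 x one_pos).le
  rw [← hu₀.heatOne_eq, mul_one] at h
  rw [mul_one] at hζ
  have h1 := Real.rpow_le_rpow (Real.rpow_nonneg (sub_nonneg.2 hζ) _) h hq.le
  rw [one_div, Real.rpow_inv_rpow (sub_nonneg.2 hζ) hq.ne'] at h1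
  have h2 : u x 1 ≤ ((1 - p) + heatOne u₀ x ^ (1 - p)) ^ (1 / (1 - p)) := by
    have h3 := Real.rpow_le_rpow (Real.rpow_nonneg (hu.nonneg hu₀ x zero_le_one) _)
      (by linarith : u x 1 ^ (1 - p) ≤ (1 - p) + heatOne u₀ x ^ (1 - p))
      (by positivity : 0 ≤ 1 / (1 - p))
    rwa [one_div, Real.rpow_rpow_inv (hu.nonneg hu₀ x zero_le_one) hq.ne', ← one_div] at h3
  unfold excess
  linarith

/-- The tangent to `y^p` at the homogeneous solution `U` lies above the graph, and `U^(p-1) =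
((1-p)t)⁻¹`. -/
lemma reaction_difference_le {p : ℝ} {u₀ : ℝ → ℝ} {u : ℝ → ℝ → ℝ} (hu : IsGlobalSolution p u₀ u)
    (hu₀ : IsInitialDatum u₀) (hp0 : 0 < p) (hp1 : p < 1)
    (x : ℝ) {t : ℝ} (ht : 0 < t) :
    u x t ^ p - ((1 - p) * t) ^ (1 / (1 - p) - 1) ≤
      p / (1 - p) * t⁻¹ * (u x t - ((1 - p) * t) ^ (1 / (1 - p))) := by
  have hq : 0 < 1 - p := by linarith
  have hqt : 0 < (1 - p) * t := by positivity
  have h := rpow_le_tangent hp0.le hp1.le (hu.nonneg hu₀ x ht.le)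
    (Real.rpow_pos_of_pos hqt (1 / (1 - p)))
  have e1 : 1 / (1 - p) * p = 1 / (1 - p) - 1 := by field_simp; ring
  have e2 : 1 / (1 - p) * (p - 1) = -1 := by field_simp; ring
  rw [← Real.rpow_mul hqt.le, ← Real.rpow_mul hqt.le, e1, e2, Real.rpow_neg_one, mul_inv] at h
  have e3 : p / (1 - p) * t⁻¹ = p * ((1 - p)⁻¹ * t⁻¹) := by ring
  rw [e3]
  linarith

/-- The rescaled deviation from the homogeneous solution is a subsolution of the heat equation
for `t ≥ 1`. -/
lemma rescaled_sub_le_heatFlow {p : ℝ} {u₀ : ℝ → ℝ} {u : ℝ → ℝ → ℝ} (hu : IsGlobalSolution p u₀ u)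
    (hu₀ : IsInitialDatum u₀) (hp0 : 0 < p) (hp1 : p < 1)
    (x : ℝ) {τ : ℝ} (hτ : 0 ≤ τ) :
    (1 + τ) ^ (-(p / (1 - p))) * (u x (1 + τ) - ((1 - p) * (1 + τ)) ^ (1 / (1 - p))) ≤
      heatFlow (excess p u₀) x τ := by
  have hq : 0 < 1 - p := by linarith
  have hm : 0 < 1 / (1 - p) := by positivity
  obtain ⟨D, Hx, hD⟩ := exists_hasParabolicDeriv_heatFlow (hu₀.integrable_excess hp1 hp0)
  obtain ⟨C, hC⟩ := hu₀.exists_abs_excess_le hp1 hp0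
  have hU : ∀ t, 0 < t → HasDerivAt (fun s => ((1 - p) * (1 + s)) ^ (1 / (1 - p)))
      (((1 - p) * (1 + t)) ^ (1 / (1 - p) - 1)) t := fun t ht => by
    have h1 : HasDerivAt (fun s : ℝ => (1 - p) * (1 + s)) ((1 - p) * 1) t :=
      ((hasDerivAt_id t).const_add 1).const_mul _
    refine (h1.rpow_const (Or.inl (by positivity))).congr_deriv ?_
    field_simp
  have hP : ∀ t, 0 < t → HasDerivAt (fun s : ℝ => (1 + s) ^ (-(p / (1 - p))))
      (-(p / (1 - p)) * (1 + t) ^ (-(p / (1 - p)) - 1)) t := fun t ht => by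
    have h1 : HasDerivAt (fun s : ℝ => 1 + s) 1 t := (hasDerivAt_id t).const_add 1
    refine (h1.rpow_const (Or.inl (by positivity))).congr_deriv ?_
    ring
  have hpd : HasParabolicDeriv
      (fun x τ => (1 + τ) ^ (-(p / (1 - p))) *
        (u x (1 + τ) - ((1 - p) * (1 + τ)) ^ (1 / (1 - p))))
      (fun x τ => -(p / (1 - p)) * (1 + τ) ^ (-(p / (1 - p)) - 1) *
        (u x (1 + τ) - ((1 - p) * (1 + τ)) ^ (1 / (1 - p))) +
        (1 + τ) ^ (-(p / (1 - p))) * (deriv (fun s => u x s) (1 + τ) -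
          ((1 - p) * (1 + τ)) ^ (1 / (1 - p) - 1)))
      (fun x τ => (1 + τ) ^ (-(p / (1 - p))) * deriv (fun y => u y (1 + τ)) x)
      (fun x τ => (1 + τ) ^ (-(p / (1 - p))) * deriv (deriv fun y => u y (1 + τ)) x) :=
    { time := fun x t ht => (hP t ht).mul
        (((hu.hasParabolicDeriv.time x (1 + t) (by linarith)).comp_const_add 1 t).sub (hU t ht))
      space := fun x t ht => ((hu.hasParabolicDeriv.space x (1 + t) (by linarith)).sub_const
        _).const_mul _
      space₂ := fun x t ht => (hu.hasParabolicDeriv.space₂ x (1 + t) (by linarith)).const_mul _ }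
  have hcont : ContinuousOn (fun z : ℝ × ℝ => (1 + z.2) ^ (-(p / (1 - p))) *
      (u z.1 (1 + z.2) - ((1 - p) * (1 + z.2)) ^ (1 / (1 - p)))) (univ ×ˢ Ici 0) := by
    refine ContinuousOn.mul (ContinuousOn.rpow_const (by fun_prop) fun z hz => Or.inl ?_)
      (ContinuousOn.sub ?_ (ContinuousOn.rpow_const (by fun_prop) fun z _ => Or.inr hm.le))
    · have : (0 : ℝ) ≤ z.2 := hz.2
      positivity
    · refine hu.continuousOn.comp (f := fun z : ℝ × ℝ => (z.1, 1 + z.2)) (by fun_prop)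
        fun z hz => ⟨mem_univ _, ?_⟩
      have : (0 : ℝ) ≤ z.2 := hz.2
      exact (by positivity : (0 : ℝ) ≤ 1 + z.2)
  rw [← sub_nonneg]
  refine heat_minimum_principle
    ((continuous_heatFlow (hu₀.continuous_excess hp1) hC).continuousOn.sub hcont)
    (hD.sub hpd) ?_ ?_ ?_ x τ hτ
  · intro x t ht
    have h1t : 0 < 1 + t := by linarith
    -- Differentiating the prefactor contributes `-(p/(1-p))/(1+t)` times the deviation, which
    -- absorbs this linear bound.
    have hle := hu.reaction_difference_le hu₀ hp0 hp1 x h1t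
    simp only [hu.equation_rpow hu₀ x h1t]
    have hr : 0 < (1 + t) ^ (-(p / (1 - p))) := Real.rpow_pos_of_pos h1t _
    have hle' := mul_le_mul_of_nonneg_left hle hr.le
    rw [Real.rpow_sub_one h1t.ne', div_eq_mul_inv _ (1 + t)]
    linarith
  · intro T hT
    obtain ⟨M, hM⟩ := hu.bounded (1 + T) (by linarith)
    refine ⟨C + M, fun x t h0 h1 => ?_⟩
    have h2 := (abs_le.1 (abs_heatFlow_le hC x t)).1
    have h3 := (abs_le.1 (hM x (1 + t) (by linarith) (by linarith))).2
    have h4 : (1 + t) ^ (-(p / (1 - p))) ≤ 1 :=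
      Real.rpow_le_one_of_one_le_of_nonpos (by linarith) (neg_nonpos.2 (by positivity))
    have h5 := sub_nonneg.2 (hu.homogeneous_le hu₀ hp0 hp1 x (by linarith : 0 ≤ 1 + t))
    have h6 : 0 ≤ ((1 - p) * (1 + t)) ^ (1 / (1 - p)) := Real.rpow_nonneg (by positivity) _
    have h7 := mul_le_of_le_one_left h5 h4
    linarith
  · intro x
    have h := hu.sub_le_excess hu₀ hp0 hp1 x
    rw [heatFlow_zero]
    simp only [add_zero, mul_one, Real.one_rpow, one_mul]
    linarith

/-- Upper bound for the deviation from the homogeneous solution. -/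
lemma sub_homogeneous_le {p : ℝ} {u₀ : ℝ → ℝ} {u : ℝ → ℝ → ℝ} (hu : IsGlobalSolution p u₀ u)
    (hu₀ : IsInitialDatum u₀) (hp0 : 0 < p) (hp1 : p < 1)
    (x : ℝ) {t : ℝ} (ht : 2 ≤ t) :
    u x t - ((1 - p) * t) ^ (1 / (1 - p)) ≤
      cPlus x t p u₀ * ((1 - p) * t) ^ ((3 * p - 1) / (2 * (1 - p))) := by
  have hq : 0 < 1 - p := by linarith
  have ht0 : 0 < t := by linarith
  have hpi := Real.pi_pos
  have h := hu.rescaled_sub_le_heatFlow hu₀ hp0 hp1 x (by linarith : 0 ≤ t - 1)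
  rw [add_sub_cancel, Real.rpow_neg ht0.le, inv_mul_le_iff₀ (Real.rpow_pos_of_pos ht0 _),
    heatFlow_eq _ _ (by linarith : 0 < t - 1)] at h
  have hI := heatIntegral_pos (hu₀.integrable_excess hp1 hp0) (hu₀.continuous_excess hp1)
    (fun s => (hu₀.excess_pos hp1 s).le) ⟨0, (hu₀.excess_pos hp1 0).ne'⟩ x
    (by linarith : 0 < t - 1)
  refine h.trans ?_
  rw [cPlus_eq, Real.rpow_neg (by linarith), ← Real.sqrt_eq_rpow]
  set I := heatIntegral (excess p u₀) x (t - 1)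
  have e1 : (3 * p - 1) / (2 * (1 - p)) = p / (1 - p) - 1 / 2 := by field_simp; ring
  have e2 : (1 - p) ^ ((1 - 2 * p) / (1 - p)) * (1 - p) ^ (p / (1 - p)) = 1 - p := by
    rw [← Real.rpow_add hq, ← add_div, show 1 - 2 * p + p = 1 - p by ring, div_self hq.ne',
      Real.rpow_one]
  rw [e1, Real.rpow_sub (by positivity), ← Real.sqrt_eq_rpow, Real.mul_rpow hq.le ht0.le]
  have e3 : (1 - p) ^ ((1 - 2 * p) / (1 - p)) / √(2 * Real.pi * (1 - p)) * I *
      ((1 - p) ^ (p / (1 - p)) * t ^ (p / (1 - p)) / √((1 - p) * t)) =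
      t ^ (p / (1 - p)) * ((√(2 * Real.pi * t))⁻¹ * I) := by
    have hs : √(2 * Real.pi * (1 - p)) * √((1 - p) * t) = (1 - p) * √(2 * Real.pi * t) := by
      rw [← Real.sqrt_mul (by positivity), show 2 * Real.pi * (1 - p) * ((1 - p) * t) =
        (1 - p) ^ 2 * (2 * Real.pi * t) by ring, Real.sqrt_mul (by positivity),
        Real.sqrt_sq hq.le]
    calc _ = ((1 - p) ^ ((1 - 2 * p) / (1 - p)) * (1 - p) ^ (p / (1 - p))) * t ^ (p / (1 - p)) * I /
          (√(2 * Real.pi * (1 - p)) * √((1 - p) * t)) := by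
          field_simp
      _ = _ := by
          rw [e2, hs]
          field_simp
  rw [e3, ← mul_assoc (2 * √Real.pi)⁻¹, ← mul_inv]
  -- Squared, this is `2πt ≤ 4π(t-1)`, i.e. `t ≥ 2`; it explains the `√(2π)` in `c₊`.
  have hsq : √(2 * Real.pi * t) ≤ 2 * √Real.pi * √(t - 1) := by
    refine Real.sqrt_le_iff.2 ⟨by positivity, ?_⟩
    rw [mul_pow, mul_pow, Real.sq_sqrt hpi.le, Real.sq_sqrt (by linarith)]
    nlinarith
  have : 0 < √(2 * Real.pi * t) := Real.sqrt_pos.2 (by positivity)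
  gcongr

/-- Lower bound for the deviation from the homogeneous solution. -/
lemma le_sub_homogeneous {p : ℝ} {u₀ : ℝ → ℝ} {u : ℝ → ℝ → ℝ} (hu : IsGlobalSolution p u₀ u)
    (hu₀ : IsInitialDatum u₀) (hp0 : 0 < p) (hp1 : p < 1)
    (x : ℝ) {t : ℝ} (ht : 0 < t) :
    cMinus x t p u₀ * ((1 - p) * t) ^ ((3 * p - 1) / (2 * (1 - p))) ≤
      u x t - ((1 - p) * t) ^ (1 / (1 - p)) := by
  have hq : 0 < 1 - p := by linarith
  have hm : 1 ≤ 1 / (1 - p) := by rw [le_div_iff₀ hq]; linarith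
  have hqt : 0 < (1 - p) * t := by positivity
  have hpi := Real.pi_pos
  have hN := hu₀.supNorm_nonneg
  have hG := hu.add_heatFlow_rpow_le hu₀ hp0 hp1 x ht.le
  -- Tangent to `y^(1/(1-p))` at `y = (1-p)t`, evaluated at `y = u^(1-p)`.
  have htan := tangent_le_rpow hm (Real.rpow_nonneg (hu.nonneg hu₀ x ht.le) (1 - p)) hqt
  rw [one_div (1 - p), Real.rpow_rpow_inv (hu.nonneg hu₀ x ht.le) hq.ne', ← one_div] at htan
  -- From `u₀ = u₀^p · u₀^(1-p)` and `u₀^p ≤ 1 + ‖u₀‖`; this is the source of the factor `(1 +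
  -- ‖u₀‖)⁻¹` in `c₋`.
  have hI : (1 + supNorm u₀)⁻¹ * heatIntegral u₀ x t ≤
      heatIntegral (fun y => u₀ y ^ (1 - p)) x t := by
    rw [heatIntegral, ← integral_const_mul]
    refine integral_mono ((integrable_heat_zero hu₀.integrable x ht).const_mul _)
      (integrable_heat_zero (hu₀.integrable_rpow hq) x ht) fun s => ?_
    simp only
    rw [← mul_assoc]
    refine mul_le_mul_of_nonneg_right ?_ (Real.exp_pos _).le
    rw [inv_mul_le_iff₀ (by positivity)]
    rcases (hu₀.nonneg s).eq_or_lt with h0 | h0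
    · rw [← h0, Real.zero_rpow hq.ne', mul_zero]
    · have h1 : u₀ s ^ p ≤ 1 + supNorm u₀ := by
        calc u₀ s ^ p ≤ (1 + supNorm u₀) ^ p := by
              refine Real.rpow_le_rpow h0.le ?_ hp0.le
              linarith [le_abs_self (u₀ s), hu₀.abs_le_supNorm s]
          _ ≤ (1 + supNorm u₀) ^ (1 : ℝ) := Real.rpow_le_rpow_of_exponent_le (by linarith) hp1.le
          _ = _ := Real.rpow_one _
      calc u₀ s = u₀ s ^ p * u₀ s ^ (1 - p) := by
            rw [← Real.rpow_add h0]; simp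
        _ ≤ _ := mul_le_mul_of_nonneg_right h1 (Real.rpow_nonneg h0.le _)
  rw [heatFlow_eq _ _ ht, Real.rpow_neg ht.le, ← Real.sqrt_eq_rpow] at hG
  have e1 : (3 * p - 1) / (2 * (1 - p)) = 1 / (1 - p) - 1 - 1 / 2 := by field_simp; ring
  rw [hu₀.cMinus_eq, e1, Real.rpow_sub hqt, ← Real.sqrt_eq_rpow]
  set A := ((1 - p) * t) ^ (1 / (1 - p) - 1)
  have hA : 0 < A := Real.rpow_pos_of_pos hqt _
  have hs : √(Real.pi * (1 - p)) * √((1 - p) * t) = (1 - p) * (√Real.pi * √t) := by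
    rw [← Real.sqrt_mul (by positivity), show Real.pi * (1 - p) * ((1 - p) * t) =
      (1 - p) ^ 2 * (Real.pi * t) by ring, Real.sqrt_mul (by positivity),
      Real.sqrt_sq hq.le, Real.sqrt_mul hpi.le]
  calc (1 + supNorm u₀)⁻¹ / (2 * √(Real.pi * (1 - p))) * heatIntegral u₀ x t *
        (A / √((1 - p) * t))
      = (1 + supNorm u₀)⁻¹ * heatIntegral u₀ x t * A /
        (2 * (√(Real.pi * (1 - p)) * √((1 - p) * t))) := by field_simp
    _ = 1 / (1 - p) * A * ((2 * √Real.pi)⁻¹ * ((√t)⁻¹ *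
        ((1 + supNorm u₀)⁻¹ * heatIntegral u₀ x t))) := by
      rw [hs]; field_simp
    _ ≤ 1 / (1 - p) * A * ((2 * √Real.pi)⁻¹ * ((√t)⁻¹ *
        heatIntegral (fun y => u₀ y ^ (1 - p)) x t)) := by gcongr
    _ ≤ 1 / (1 - p) * A * (u x t ^ (1 - p) - (1 - p) * t) := by
      gcongr
      linarith
    _ ≤ _ := by linarith

end IsGlobalSolution

end SublinearFujita

/-! ### Assembly of the estimates. -/

theorem theorem1p2 (p : ℝ) (hp0 : 0 < p) (hp1 : p < 1)
    (u₀ : ℝ → ℝ) (hu₀ : SublinearFujita.IsInitialDatum u₀)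
    (u : ℝ → ℝ → ℝ) (hu : SublinearFujita.IsGlobalSolution p u₀ u) :
    (∀ᶠ t : ℝ in Filter.atTop, ∀ x : ℝ,
      SublinearFujita.cMinus x t p u₀ * ((1 - p) * t) ^ ((3 * p - 1) / (2 * (1 - p)))
        ≤ u x t - ((1 - p) * t) ^ (1 / (1 - p))) ∧
    (∀ᶠ t : ℝ in Filter.atTop, ∀ x : ℝ,
      u x t - ((1 - p) * t) ^ (1 / (1 - p))
        ≤ SublinearFujita.cPlus x t p u₀ * ((1 - p) * t) ^ ((3 * p - 1) / (2 * (1 - p)))) ∧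
    (∀ t : ℝ, 1 < t → ∀ x : ℝ,
      MeasureTheory.Integrable (fun s : ℝ =>
        SublinearFujita.excess p u₀ s * Real.exp (-((s - x) ^ 2 / (4 * (t - 1))))) ∧
      0 < SublinearFujita.cMinus x t p u₀ ∧ 0 < SublinearFujita.cPlus x t p u₀) ∧
    (∃ M : ℝ, ∀ᶠ t : ℝ in Filter.atTop, ∀ x : ℝ,
      SublinearFujita.cMinus x t p u₀ ≤ M ∧ SublinearFujita.cPlus x t p u₀ ≤ M) := by
  have hq : 0 < 1 - p := by linarith
  have hpi := Real.pi_pos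
  have hN := hu₀.supNorm_nonneg
  have hA : 0 < (1 + SublinearFujita.supNorm u₀)⁻¹ / (2 * √(Real.pi * (1 - p))) := by positivity
  have hB : 0 < (1 - p) ^ ((1 - 2 * p) / (1 - p)) / √(2 * Real.pi * (1 - p)) := by positivity
  have hE := hu₀.integrable_excess hp1 hp0
  have hE0 := hu₀.excess_pos hp1
  refine ⟨?_, ?_, ?_, ?_⟩
  · filter_upwards [Filter.eventually_gt_atTop 0] with t ht x
    exact hu.le_sub_homogeneous hu₀ hp0 hp1 x ht
  · filter_upwards [Filter.eventually_ge_atTop 2] with t ht x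
    exact hu.sub_homogeneous_le hu₀ hp0 hp1 x ht
  · intro t ht x
    refine ⟨SublinearFujita.integrable_heat_zero hE x (by linarith), ?_, ?_⟩
    · rw [hu₀.cMinus_eq]
      exact mul_pos hA (SublinearFujita.heatIntegral_pos hu₀.integrable hu₀.continuous hu₀.nonneg
        hu₀.nontrivial x (by linarith))
    · rw [SublinearFujita.cPlus_eq]
      exact mul_pos hB (SublinearFujita.heatIntegral_pos hE (hu₀.continuous_excess hp1)
        (fun s => (hE0 s).le) ⟨0, (hE0 0).ne'⟩ x (by linarith))
  -- The kernels are at most `1`, so the total masses bound both coefficients uniformly in `x` and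
  -- `t`.
  · refine ⟨max
      ((1 + SublinearFujita.supNorm u₀)⁻¹ / (2 * √(Real.pi * (1 - p))) * ∫ s, u₀ s)
      ((1 - p) ^ ((1 - 2 * p) / (1 - p)) / √(2 * Real.pi * (1 - p)) *
        ∫ s, SublinearFujita.excess p u₀ s), ?_⟩
    filter_upwards [Filter.eventually_gt_atTop 1] with t ht x
    constructor
    · refine le_max_of_le_left ?_
      rw [hu₀.cMinus_eq]
      exact mul_le_mul_of_nonneg_left (SublinearFujita.heatIntegral_le hu₀.integrable hu₀.nonneg x
        (by linarith)) hA.le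
    · refine le_max_of_le_right ?_
      rw [SublinearFujita.cPlus_eq]
      exact mul_le_mul_of_nonneg_left (SublinearFujita.heatIntegral_le hE (fun s => (hE0 s).le) x
        (by linarith)) hB.le
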